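/- Write the points of $\mathbb R^4$ as $c=(c_{11},c_{12},c_{21},c_{22})$. The following six subsets of $\mathbb R^4$ are equal: (a) the set of all $c$ for which there are a separable complex Hilbert space $\mathcal H$, a positive Hermitian operator $\rho$ on $\mathcal H$ with $\mathrm{tr}(\rho)=1$, and Hermitian operators $A_1,A_2,B_1,B_2$ on $\mathcal H$ with $-\mathbf 1\le A_i\le\mathbf 1$, $-\mathbf 1\le B_j\le\mathbf 1$ and $A_iB_j=B_jA_i$, such that $c_{ij}=\mathrm{tr}(\rho A_iB_j)$ for all $i,j\in\{1,2\}$; (b) the convex hull of $\{(\cos\alpha,\cos\beta,\cos\gamma,\cos\delta) : \alpha,\beta,\gamma,\delta\in\mathbb R,\ \alpha+\beta+\gamma+\delta\equiv 0 \bmod 2\pi\}$; (c) the image of the demicube, i.e. of the convex hull of the eight points of $\{-1,1\}^4$ with an even number of coordinates $-1$, under the map $c\mapsto\bigl(\sin(\tfrac{\pi}{2}c_{ij})\bigr)_{i,j}$, which is a homeomorphism of the cube $[-1,1]^4$ onto itself; (d) the set of all $c\in[-1,1]^4$ such that $g(c)\ge 0$ or $h(c)\ge 0$, where $$g(c)=2-(c_{11}^2+c_{12}^2+c_{21}^2+c_{22}^2)+2c_{11}c_{12}c_{21}c_{22},$$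 $$h(c)=4(1-c_{11}^2)(1-c_{12}^2)(1-c_{21}^2)(1-c_{22}^2)-g(c)^2;$$ (e) the set of all $c\in\mathbb R^4$ such that for some $u,v\in\mathbb R$ the matrix $$\begin{pmatrix}1&u&c_{11}&c_{12}\\u&1&c_{21}&c_{22}\\c_{11}&c_{21}&1&v\\c_{12}&c_{22}&v&1\end{pmatrix}$$ is positive semidefinite; (f) the set of all $c$ for which there are unit vectors $a_1,a_2,b_1,b_2$ in some Euclidean space $\mathbb R^n$ with $c_{ij}=a_i\cdot b_j$ for all $i,j\in\{1,2\}$. -/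

import Mathlib

universe u

namespace CorrelationBody

open scoped InnerProductSpace

/-- The space `ℝ⁴` of points `c = (c₁₁, c₁₂, c₂₁, c₂₂)`; the coordinate `cᵢⱼ` is `c (i-1) (j-1)`. -/
abbrev R4 : Type := Fin 2 → Fin 2 → ℝ

/-- The point of `ℝ⁴` with the given four coordinates. -/
def point (c₁₁ c₁₂ c₂₁ c₂₂ : ℝ) : R4 := ![![c₁₁, c₁₂], ![c₂₁, c₂₂]]

/-- The cube `[-1,1]⁴`. -/
def cube : Set R4 := {c | ∀ i j, -1 ≤ c i j ∧ c i j ≤ 1}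

/-- The even vertices of the cube: the sign vectors with an even number of entries `-1`. -/
def evenVertices : Set R4 :=
  {c | (∀ i j, c i j = 1 ∨ c i j = -1) ∧ ∏ i, ∏ j, c i j = 1}

/-- The demicube, the convex hull of the even vertices of the cube. -/
def demicube : Set R4 := convexHull ℝ evenVertices

/-- The coordinatewise map `c ↦ sin (π c / 2)`. -/
noncomputable def pushout (c : R4) : R4 := fun i j => Real.sin (Real.pi / 2 * c i j)

/-- The bounded operator `T` on the complex Hilbert space `H` is of trace class with trace `t`: in
every Hilbert basis the diagonal series `∑ ⟨eₖ, T eₖ⟩` converges unconditionally (equivalently,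
absolutely) with sum `t`. -/
def HasTrace {H : Type u} [NormedAddCommGroup H] [InnerProductSpace ℂ H]
    (T : H →L[ℂ] H) (t : ℂ) : Prop :=
  ∀ (κ : Type u) (e : HilbertBasis κ ℂ H), HasSum (fun k => ⟪e k, T (e k)⟫_ℂ) t

/-- `ρ` is a density operator: a positive Hermitian operator with trace one. -/
structure IsDensityOperator {H : Type u} [NormedAddCommGroup H] [InnerProductSpace ℂ H]
    (ρ : H →L[ℂ] H) : Prop where
  pos : ρ.IsPositive
  trace_eq_one : HasTrace ρ 1

/-- `A` is Hermitian and `-1 ≤ A ≤ 1` as operators. -/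
structure IsHermitianContraction {H : Type u} [NormedAddCommGroup H] [InnerProductSpace ℂ H]
    [CompleteSpace H] (A : H →L[ℂ] H) : Prop where
  selfAdjoint : IsSelfAdjoint A
  neg_one_le : -1 ≤ A
  le_one : A ≤ 1

/-- The state `ρ` and the measurements `A₁, A₂` and `B₁, B₂` on `H` form a quantum model of the
correlations `c`. -/
structure IsQuantumModel {H : Type u} [NormedAddCommGroup H] [InnerProductSpace ℂ H]
    [CompleteSpace H] (ρ : H →L[ℂ] H) (A B : Fin 2 → H →L[ℂ] H) (c : R4) : Prop where
  density : IsDensityOperator ρ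
  alice : ∀ i, IsHermitianContraction (A i)
  bob : ∀ j, IsHermitianContraction (B j)
  commute : ∀ i j, Commute (A i) (B j)
  trace_eq : ∀ i j, HasTrace (ρ * A i * B j) (c i j : ℂ)

/-- (a) The quantum correlations. -/
def quantumCorrelations : Set R4 :=
  {c | ∃ (H : Type u) (_ : NormedAddCommGroup H) (_ : InnerProductSpace ℂ H) (_ : CompleteSpace H)
    (_ : TopologicalSpace.SeparableSpace H) (ρ : H →L[ℂ] H) (A B : Fin 2 → H →L[ℂ] H),
    IsQuantumModel ρ A B c}

/-- The cosine hypersurface `(cos α, cos β, cos γ, cos δ)`, `α + β + γ + δ ≡ 0 mod 2π`. -/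
def cosineSurface : Set R4 :=
  {c | ∃ α β γ δ : ℝ, (∃ k : ℤ, α + β + γ + δ = k * (2 * Real.pi)) ∧
    c = point (Real.cos α) (Real.cos β) (Real.cos γ) (Real.cos δ)}

/-- The polynomial `g`. -/
def g (c : R4) : ℝ :=
  2 - (c 0 0 ^ 2 + c 0 1 ^ 2 + c 1 0 ^ 2 + c 1 1 ^ 2) + 2 * c 0 0 * c 0 1 * c 1 0 * c 1 1

/-- The polynomial `h`. -/
def h (c : R4) : ℝ :=
  4 * (1 - c 0 0 ^ 2) * (1 - c 0 1 ^ 2) * (1 - c 1 0 ^ 2) * (1 - c 1 1 ^ 2) - g c ^ 2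

/-- (d) The semialgebraic set. -/
def semialgebraicSet : Set R4 := {c | c ∈ cube ∧ (0 ≤ g c ∨ 0 ≤ h c)}

/-- The symmetric `4 × 4` matrix with unit diagonal, off-diagonal block `c`, and the remaining
entries `u` and `v`. -/
def completion (c : R4) (u v : ℝ) : Matrix (Fin 4) (Fin 4) ℝ :=
  !![1,     u,     c 0 0, c 0 1;
     u,     1,     c 1 0, c 1 1;
     c 0 0, c 1 0, 1,     v;
     c 0 1, c 1 1, v,     1]

/-- (e) The spectrahedral shadow. -/
def spectrahedralShadow : Set R4 := {c | ∃ u v : ℝ, (completion c u v).PosSemidef}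

/-- (f) The scalar products of pairs of unit vectors in some Euclidean space. -/
def unitVectorCorrelations : Set R4 :=
  {c | ∃ (n : ℕ) (a b : Fin 2 → EuclideanSpace ℝ (Fin n)),
    (∀ i, ‖a i‖ = 1) ∧ (∀ j, ‖b j‖ = 1) ∧ ∀ i j, c i j = ⟪a i, b j⟫_ℝ}

end CorrelationBody

namespace CorrelationBody

open scoped InnerProductSpace

/-! All six sets coincide with `chordalSet`. A positive semidefinite completion has nonnegative 3 ×
3 principal minors, and two of these involve `u` but not `v`. Conversely, a chord `u` fixes planar
unit vectors a₁, a₂ with a₁ · a₂ = u. Then b₁ and b₂ can be found separately in the unit disc and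
lifted to the sphere in ℝ³, so `v` never has to be chosen.

Each minor condition confines `u` to an interval, so a chord exists exactly when two intervals meet.
Written algebraically this is the condition on g and h (`chordalSet_eq_semialgebraicSet`). Written
in angles it is a system of spherical triangle inequalities, which are linear and cut out the
demicube (`pushout_image_demicube`).

The cosine surface consists of planar configurations, so its hull lies in the convex set
`spectrahedralShadow`. For the converse, the sine map sends axis-parallel segments to segments;
moving a demicube point along the axes ends on odd facets or at vertices, whose images lie on the
surface (`IsDemicubePoint.sinPoint_mem`).

In a quantum model, Aᵢ√ρ and Bⱼ√ρ are vectors in the Hilbert–Schmidt unit ball with scalar products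
cᵢⱼ. Conversely, two-qubit reflections in a Bell state realize planar scalar products. -/

/-- The determinant of the symmetric `3 × 3` matrix with unit diagonal and off-diagonal entries
`u`, `x`, `y`. -/
def gramDet (u x y : ℝ) : ℝ := 1 + 2 * u * x * y - u ^ 2 - x ^ 2 - y ^ 2

/-- The points of the cube for which some chord `u` makes both `3 × 3` blocks of the completion
containing it positive semidefinite. -/
def chordalSet : Set R4 :=
  {c | c ∈ cube ∧ ∃ u : ℝ, u ^ 2 ≤ 1 ∧ 0 ≤ gramDet u (c 0 0) (c 1 0) ∧
    0 ≤ gramDet u (c 0 1) (c 1 1)}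

/-! ### Unit vectors and positive semidefinite completions -/

lemma sq_le_one_of_mem_cube {c : R4} (hc : c ∈ cube) (i j : Fin 2) : c i j ^ 2 ≤ 1 := by
  have := hc i j
  nlinarith

lemma sq_le_one_of_posSemidef {n : Type*} {M : Matrix n n ℝ}
    (hM : M.PosSemidef) (i j : n) (hi : M i i = 1) (hj : M j j = 1) : M i j ^ 2 ≤ 1 := by
  have h := (hM.submatrix ![i, j]).det_nonneg
  have hs : M j i = M i j := by simpa using hM.1.apply i j
  rw [Matrix.det_fin_two] at h
  simp [hi, hj, hs] at h
  nlinarith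

lemma gramDet_nonneg_of_posSemidef {n : Type*} {M : Matrix n n ℝ}
    (hM : M.PosSemidef) (i j k : n) (hi : M i i = 1) (hj : M j j = 1) (hk : M k k = 1) :
    0 ≤ gramDet (M i j) (M i k) (M j k) := by
  -- The index map need not be injective, so repeated indices are harmless.
  have h := (hM.submatrix ![i, j, k]).det_nonneg
  have hs : M j i = M i j := by simpa using hM.1.apply i j
  have hs' : M k i = M i k := by simpa using hM.1.apply i k
  have hs'' : M k j = M j k := by simpa using hM.1.apply j k
  rw [Matrix.det_fin_three] at h
  simp [hi, hj, hk, hs, hs', hs''] at h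
  unfold gramDet
  nlinarith

lemma spectrahedralShadow_subset_chordalSet : spectrahedralShadow ⊆ chordalSet := by
  rintro c ⟨u, v, hM⟩
  have hd : ∀ i, completion c u v i i = 1 := by
    intro i; fin_cases i <;> rfl
  have key : ∀ i j, completion c u v i j ^ 2 ≤ 1 := fun i j =>
    sq_le_one_of_posSemidef hM i j (hd i) (hd j)
  have tri : ∀ i j k, 0 ≤ gramDet (completion c u v i j) (completion c u v i k)
      (completion c u v j k) := fun i j k =>
    gramDet_nonneg_of_posSemidef hM i j k (hd i) (hd j) (hd k)
  refine ⟨?_, u, key 0 1, tri 0 1 2, tri 0 1 3⟩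
  intro i j
  rw [← abs_le, ← sq_le_one_iff_abs_le_one]
  fin_cases i <;> fin_cases j
  exacts [key 0 2, key 0 3, key 1 2, key 1 3]

/-- The third side of a spherical triangle can be realized by a vector of the unit disc whose
scalar products with the unit vectors `(1, 0)` and `(u, √(1 - u²))` are prescribed. -/
lemma exists_disc_vector {u x y : ℝ} (hu : u ^ 2 ≤ 1) (hx : x ^ 2 ≤ 1)
    (h : 0 ≤ gramDet u x y) :
    ∃ z : ℝ, x ^ 2 + z ^ 2 ≤ 1 ∧ u * x + √(1 - u ^ 2) * z = y := by
  -- `gramDet` with the square completed in `y`; when u² = 1 it forces y = u x.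
  have h' : (y - u * x) ^ 2 ≤ (1 - u ^ 2) * (1 - x ^ 2) := by
    unfold gramDet at h; nlinarith
  rcases hu.eq_or_lt with hu | hu
  · refine ⟨0, by simpa using hx, ?_⟩
    have : (y - u * x) ^ 2 ≤ 0 := by simpa [hu] using h'
    have := pow_eq_zero_iff (two_ne_zero) |>.1 (le_antisymm this (sq_nonneg _))
    linarith
  · have hs : 0 < √(1 - u ^ 2) := Real.sqrt_pos.2 (by linarith)
    refine ⟨(y - u * x) / √(1 - u ^ 2), ?_, by field_simp; ring⟩
    rw [div_pow, Real.sq_sqrt (by linarith)]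
    have : (y - u * x) ^ 2 / (1 - u ^ 2) ≤ 1 - x ^ 2 := by
      rw [div_le_iff₀ (by linarith)]; linarith
    linarith

/-- Every point of the chordal set consists of scalar products of two planar unit vectors with two
vectors of the unit disc. -/
lemma exists_planar_vectors {c : R4} (hc : c ∈ chordalSet) :
    ∃ p q r s : Fin 2 → ℝ, (∀ i, p i ^ 2 + q i ^ 2 = 1) ∧ (∀ j, r j ^ 2 + s j ^ 2 ≤ 1) ∧
      ∀ i j, c i j = p i * r j + q i * s j := by
  obtain ⟨hc, u, hu, h₀, h₁⟩ := hc
  obtain ⟨z₀, hz₀, hz₀'⟩ := exists_disc_vector hu (sq_le_one_of_mem_cube hc 0 0) h₀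
  obtain ⟨z₁, hz₁, hz₁'⟩ := exists_disc_vector hu (sq_le_one_of_mem_cube hc 0 1) h₁
  have hs := Real.sq_sqrt (show 0 ≤ 1 - u ^ 2 by linarith)
  -- With a₁ = (1, 0), the first coordinate of bⱼ must be c₁ⱼ.
  refine ⟨![1, u], ![0, √(1 - u ^ 2)], ![c 0 0, c 0 1], ![z₀, z₁], ?_, ?_, ?_⟩
  · simp [Fin.forall_fin_two, hs]
  · simpa [Fin.forall_fin_two] using ⟨hz₀, hz₁⟩
  · simp [Fin.forall_fin_two, hz₀', hz₁']

/-- A third coordinate, orthogonal to both aᵢ, brings each bⱼ to length one without changing scalar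
products. -/
lemma chordalSet_subset_unitVectorCorrelations : chordalSet ⊆ unitVectorCorrelations := by
  intro c hc
  obtain ⟨p, q, r, s, ha, hb, hab⟩ := exists_planar_vectors hc
  refine ⟨3, fun i => !₂[p i, q i, 0], fun j => !₂[r j, s j, √(1 - r j ^ 2 - s j ^ 2)],
    fun i => ?_, fun j => ?_, fun i j => ?_⟩
  · simp [EuclideanSpace.norm_eq, Fin.sum_univ_three, ha]
  · have := Real.sq_sqrt (show 0 ≤ 1 - r j ^ 2 - s j ^ 2 by linarith [hb j])
    simp [EuclideanSpace.norm_eq, Fin.sum_univ_three, this]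
  · simp [PiLp.inner_apply, Fin.sum_univ_three, hab]
    ring

/-- Scalar products of vectors in the unit ball of a real inner product space lie in the
spectrahedral shadow. -/
lemma mem_spectrahedralShadow_of_inner {E : Type*} [NormedAddCommGroup E]
    [InnerProductSpace ℝ E] {c : R4} {a b : Fin 2 → E} (ha : ∀ i, ‖a i‖ ≤ 1)
    (hb : ∀ j, ‖b j‖ ≤ 1) (h : ∀ i j, c i j = ⟪a i, b j⟫_ℝ) : c ∈ spectrahedralShadow := by
  refine ⟨⟪a 0, a 1⟫_ℝ, ⟪b 0, b 1⟫_ℝ, ?_⟩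
  have hw : ∀ x : E, ‖x‖ ≤ 1 → 0 ≤ 1 - ‖x‖ ^ 2 := fun x hx => by
    nlinarith [norm_nonneg x]
  -- The diagonal term makes up for vectors shorter than one.
  have key : completion c ⟪a 0, a 1⟫_ℝ ⟪b 0, b 1⟫_ℝ =
      Matrix.gram ℝ ![a 0, a 1, b 0, b 1] + Matrix.diagonal
        ![1 - ‖a 0‖ ^ 2, 1 - ‖a 1‖ ^ 2, 1 - ‖b 0‖ ^ 2, 1 - ‖b 1‖ ^ 2] := by
    ext i j
    fin_cases i <;> fin_cases j <;>
      simp [completion, Matrix.gram_apply, h, real_inner_comm, Matrix.diagonal]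
  rw [key]
  refine (Matrix.posSemidef_gram ℝ _).add (Matrix.PosSemidef.diagonal ?_)
  intro i
  fin_cases i
  exacts [hw _ (ha 0), hw _ (ha 1), hw _ (hb 0), hw _ (hb 1)]

lemma unitVectorCorrelations_subset_spectrahedralShadow :
    unitVectorCorrelations ⊆ spectrahedralShadow := by
  rintro c ⟨n, a, b, ha, hb, h⟩
  exact mem_spectrahedralShadow_of_inner (fun i => (ha i).le) (fun j => (hb j).le) h

lemma spectrahedralShadow_eq_chordalSet : spectrahedralShadow = chordalSet :=
  spectrahedralShadow_subset_chordalSet.antisymm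
    (chordalSet_subset_unitVectorCorrelations.trans
      unitVectorCorrelations_subset_spectrahedralShadow)

lemma unitVectorCorrelations_eq_chordalSet : unitVectorCorrelations = chordalSet :=
  (unitVectorCorrelations_subset_spectrahedralShadow.trans
    spectrahedralShadow_subset_chordalSet).antisymm chordalSet_subset_unitVectorCorrelations

/-! ### The cosine surface inside the spectrahedral shadow -/

lemma convex_spectrahedralShadow : Convex ℝ spectrahedralShadow := by
  rintro c ⟨u, v, hc⟩ c' ⟨u', v', hc'⟩ s t hs ht hst
  refine ⟨s * u + t * u', s * v + t * v', ?_⟩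
  have key : completion (s • c + t • c') (s * u + t * u') (s * v + t * v') =
      s • completion c u v + t • completion c' u' v' := by
    ext i j
    fin_cases i <;> fin_cases j <;> simp [completion, hst]
  rw [key]
  exact (hc.smul hs).add (hc'.smul ht)

lemma cosineSurface_subset_unitVectorCorrelations : cosineSurface ⊆ unitVectorCorrelations := by
  rintro _ ⟨α, β, γ, δ, ⟨k, hk⟩, rfl⟩
  have hδ : Real.cos δ = Real.cos (α + β + γ) := by
    rw [show δ = k * (2 * Real.pi) - (α + β + γ) by linarith, Real.cos_int_mul_two_pi_sub]
  let e : ℝ → EuclideanSpace ℝ (Fin 2) := fun t => !₂[Real.cos t, Real.sin t]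
  have he : ∀ t, ‖e t‖ = 1 := fun t => by simp [e, EuclideanSpace.norm_eq]
  have hi : ∀ s t, ⟪e s, e t⟫_ℝ = Real.cos (s - t) := fun s t => by
    simp [e, PiLp.inner_apply, Real.cos_sub]; ring
  -- The angle differences are α, β, γ and α + β + γ ≡ -δ, up to sign.
  refine ⟨2, ![e 0, e (α + γ)], ![e α, e (-β)], ?_, ?_, ?_⟩
  · simp [Fin.forall_fin_two, he]
  · simp [Fin.forall_fin_two, he]
  · simp [Fin.forall_fin_two, hi, point, hδ]
    ring_nf

lemma convexHull_cosineSurface_subset_chordalSet :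
    convexHull ℝ cosineSurface ⊆ chordalSet := by
  rw [← spectrahedralShadow_eq_chordalSet]
  exact convexHull_min (cosineSurface_subset_unitVectorCorrelations.trans
    unitVectorCorrelations_subset_spectrahedralShadow) convex_spectrahedralShadow

/-! ### The semialgebraic description -/

lemma gramDet_eq (u x y : ℝ) :
    gramDet u x y = (1 - x ^ 2) * (1 - y ^ 2) - (u - x * y) ^ 2 := by
  unfold gramDet; ring

lemma sq_le_one_of_gramDet_nonneg {u x y : ℝ} (hx : x ^ 2 ≤ 1) (hy : y ^ 2 ≤ 1)
    (h : 0 ≤ gramDet u x y) : u ^ 2 ≤ 1 := by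
  have h₁ : (y - u * x) ^ 2 ≤ (1 - u ^ 2) * (1 - x ^ 2) := by
    unfold gramDet at h; linarith
  rcases hx.eq_or_lt with hx | hx
  · have h₂ := gramDet_eq u x y
    rw [hx] at h₂
    have h₃ : u - x * y = 0 := by
      have : (u - x * y) ^ 2 ≤ 0 := by linarith
      exact pow_eq_zero_iff two_ne_zero |>.1 (le_antisymm this (sq_nonneg _))
    rw [show u = x * y by linarith, mul_pow, hx, one_mul]
    exact hy
  · by_contra! hu
    nlinarith [sq_nonneg (y - u * x), mul_pos (sub_pos.2 hu) (sub_pos.2 hx)]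

/-- The second expression factors as ((s + t)² - d²)(d² - (s - t)²). It misses the case |d| < |s -
t|, which the first alternative covers. -/
lemma abs_sub_le_iff_of_sq {s t d : ℝ} (hs : 0 ≤ s) (ht : 0 ≤ t) :
    |d| ≤ s + t ↔ 0 ≤ s ^ 2 + t ^ 2 - d ^ 2 ∨
      0 ≤ 4 * s ^ 2 * t ^ 2 - (s ^ 2 + t ^ 2 - d ^ 2) ^ 2 := by
  have hd := abs_nonneg d
  rw [← sq_abs d]
  generalize |d| = d at *
  have hf : 4 * s ^ 2 * t ^ 2 - (s ^ 2 + t ^ 2 - d ^ 2) ^ 2 =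
      ((s + t) ^ 2 - d ^ 2) * (d ^ 2 - (s - t) ^ 2) := by ring
  constructor
  · intro h
    by_contra! hn
    rw [hf] at hn
    have h₁ : 0 ≤ (s + t) ^ 2 - d ^ 2 := by nlinarith
    have h₂ : 0 ≤ d ^ 2 - (s - t) ^ 2 := by nlinarith [mul_nonneg hs ht]
    exact absurd (mul_nonneg h₁ h₂) (not_le.2 hn.2)
  · intro h
    by_contra! hn
    have h₁ : (s + t) ^ 2 - d ^ 2 < 0 := by nlinarith
    have h₂ : 0 < d ^ 2 - (s - t) ^ 2 := by nlinarith [mul_nonneg hs ht]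
    rw [hf] at h
    rcases h with h | h
    · nlinarith [mul_nonneg hs ht]
    · nlinarith [mul_pos (neg_pos.2 h₁) h₂]

/-- The two admissible intervals for `u` are centred at c₁₁c₂₁ and c₁₂c₂₂; they meet iff the
distance of the centres is at most the sum of the radii. -/
lemma chordalSet_eq_semialgebraicSet : chordalSet = semialgebraicSet := by
  ext c
  refine and_congr_right fun hc => ?_
  have h' := sq_le_one_of_mem_cube hc
  have hS : 0 ≤ (1 - c 0 0 ^ 2) * (1 - c 1 0 ^ 2) :=
    mul_nonneg (sub_nonneg.2 (h' 0 0)) (sub_nonneg.2 (h' 1 0))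
  have hT : 0 ≤ (1 - c 0 1 ^ 2) * (1 - c 1 1 ^ 2) :=
    mul_nonneg (sub_nonneg.2 (h' 0 1)) (sub_nonneg.2 (h' 1 1))
  have hg : g c = √((1 - c 0 0 ^ 2) * (1 - c 1 0 ^ 2)) ^ 2 +
      √((1 - c 0 1 ^ 2) * (1 - c 1 1 ^ 2)) ^ 2 -
      (c 0 0 * c 1 0 - c 0 1 * c 1 1) ^ 2 := by
    rw [Real.sq_sqrt hS, Real.sq_sqrt hT, g]; ring
  have hh : h c = 4 * √((1 - c 0 0 ^ 2) * (1 - c 1 0 ^ 2)) ^ 2 *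
      √((1 - c 0 1 ^ 2) * (1 - c 1 1 ^ 2)) ^ 2 - g c ^ 2 := by
    rw [Real.sq_sqrt hS, Real.sq_sqrt hT, h]; ring
  rw [hh, hg, ← abs_sub_le_iff_of_sq (Real.sqrt_nonneg _) (Real.sqrt_nonneg _)]
  simp only [gramDet_eq, sub_nonneg]
  rw [abs_le]
  constructor
  · rintro ⟨u, -, h₁, h₂⟩
    have h₁ := abs_le.1 (Real.abs_le_sqrt h₁)
    have h₂ := abs_le.1 (Real.abs_le_sqrt h₂)
    constructor <;> linarith
  · rintro ⟨h₁, h₂⟩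
    have aux : ∀ {x S : ℝ}, 0 ≤ S → |x| ≤ √S → x ^ 2 ≤ S := fun hS h => by
      rw [← Real.sq_sqrt hS]; exact sq_le_sq.2 (h.trans (le_abs_self _))
    have n₁ := Real.sqrt_nonneg ((1 - c 0 0 ^ 2) * (1 - c 1 0 ^ 2))
    have n₂ := Real.sqrt_nonneg ((1 - c 0 1 ^ 2) * (1 - c 1 1 ^ 2))
    obtain ⟨u, hu₁, hu₂⟩ : ∃ u : ℝ,
        |u - c 0 0 * c 1 0| ≤ √((1 - c 0 0 ^ 2) * (1 - c 1 0 ^ 2)) ∧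
        |u - c 0 1 * c 1 1| ≤ √((1 - c 0 1 ^ 2) * (1 - c 1 1 ^ 2)) := by
      -- The larger of the two left endpoints lies in both intervals.
      refine ⟨max (c 0 0 * c 1 0 - √((1 - c 0 0 ^ 2) * (1 - c 1 0 ^ 2)))
        (c 0 1 * c 1 1 - √((1 - c 0 1 ^ 2) * (1 - c 1 1 ^ 2))), ?_, ?_⟩ <;>
      rw [abs_le] <;>
      rcases max_cases (c 0 0 * c 1 0 - √((1 - c 0 0 ^ 2) * (1 - c 1 0 ^ 2)))
        (c 0 1 * c 1 1 - √((1 - c 0 1 ^ 2) * (1 - c 1 1 ^ 2))) with ⟨h, h'⟩ | ⟨h, h'⟩ <;>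
      rw [h] <;> constructor <;> linarith
    refine ⟨u, ?_, aux hS hu₁, aux hT hu₂⟩
    exact sq_le_one_of_gramDet_nonneg (h' 0 0) (h' 1 0)
      (by rw [gramDet_eq]; exact sub_nonneg.2 (aux hS hu₁))

/-! ### Facets of the demicube -/

/-- The facet description of the demicube in the four coordinates. -/
structure IsDemicubePoint (x₁ x₂ x₃ x₄ : ℝ) : Prop where
  coord₁ : |x₁| ≤ 1
  coord₂ : |x₂| ≤ 1
  coord₃ : |x₃| ≤ 1
  coord₄ : |x₄| ≤ 1
  facet₁ : |-x₁ + x₂ + x₃ + x₄| ≤ 2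
  facet₂ : |x₁ - x₂ + x₃ + x₄| ≤ 2
  facet₃ : |x₁ + x₂ - x₃ + x₄| ≤ 2
  facet₄ : |x₁ + x₂ + x₃ - x₄| ≤ 2

lemma eq_point (c : R4) : c = point (c 0 0) (c 0 1) (c 1 0) (c 1 1) := by
  ext i j; fin_cases i <;> fin_cases j <;> rfl

lemma convex_abs_le {E : Type*} [AddCommGroup E] [Module ℝ E] (f : E →ₗ[ℝ] ℝ) (r : ℝ) :
    Convex ℝ {x | |f x| ≤ r} := by
  have : {x | |f x| ≤ r} = f ⁻¹' Set.Icc (-r) r := by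
    ext x; simp [abs_le]
  rw [this]
  exact (convex_Icc _ _).linear_preimage f

lemma abs_le_of_mem_demicube {x : R4} (hx : x ∈ demicube) (f : R4 →ₗ[ℝ] ℝ) (r : ℝ)
    (hf : ∀ v ∈ evenVertices, |f v| ≤ r) : |f x| ≤ r :=
  convexHull_min hf (convex_abs_le f r) hx

/-- The linear functional on `ℝ⁴` with the given coefficients. -/
def functional (k₁ k₂ k₃ k₄ : ℝ) : R4 →ₗ[ℝ] ℝ where
  toFun c := k₁ * c 0 0 + k₂ * c 0 1 + k₃ * c 1 0 + k₄ * c 1 1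
  map_add' := by intros; simp; ring
  map_smul' := by intros; simp; ring

lemma isDemicubePoint_of_mem_demicube {x : R4} (hx : x ∈ demicube) :
    IsDemicubePoint (x 0 0) (x 0 1) (x 1 0) (x 1 1) := by
  have key : ∀ k₁ k₂ k₃ k₄ r : ℝ,
      (∀ y₁ y₂ y₃ y₄ : ℝ, (y₁ = 1 ∨ y₁ = -1) → (y₂ = 1 ∨ y₂ = -1) → (y₃ = 1 ∨ y₃ = -1) →
        (y₄ = 1 ∨ y₄ = -1) → y₁ * y₂ * (y₃ * y₄) = 1 →
        |k₁ * y₁ + k₂ * y₂ + k₃ * y₃ + k₄ * y₄| ≤ r) →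
      |k₁ * x 0 0 + k₂ * x 0 1 + k₃ * x 1 0 + k₄ * x 1 1| ≤ r := by
    intro k₁ k₂ k₃ k₄ r h
    refine abs_le_of_mem_demicube hx (functional k₁ k₂ k₃ k₄) r ?_
    rintro v ⟨hv, hp⟩
    refine h _ _ _ _ (hv 0 0) (hv 0 1) (hv 1 0) (hv 1 1) ?_
    simpa [Fin.prod_univ_two] using hp
  constructor
  · convert key 1 0 0 0 1 ?_ using 2
    · ring
    · rintro _ _ _ _ (rfl | rfl) (rfl | rfl) (rfl | rfl) (rfl | rfl) <;> norm_num
  · convert key 0 1 0 0 1 ?_ using 2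
    · ring
    · rintro _ _ _ _ (rfl | rfl) (rfl | rfl) (rfl | rfl) (rfl | rfl) <;> norm_num
  · convert key 0 0 1 0 1 ?_ using 2
    · ring
    · rintro _ _ _ _ (rfl | rfl) (rfl | rfl) (rfl | rfl) (rfl | rfl) <;> norm_num
  · convert key 0 0 0 1 1 ?_ using 2
    · ring
    · rintro _ _ _ _ (rfl | rfl) (rfl | rfl) (rfl | rfl) (rfl | rfl) <;> norm_num
  · convert key (-1) 1 1 1 2 ?_ using 2
    · ring
    · rintro _ _ _ _ (rfl | rfl) (rfl | rfl) (rfl | rfl) (rfl | rfl) <;> norm_num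
  · convert key 1 (-1) 1 1 2 ?_ using 2
    · ring
    · rintro _ _ _ _ (rfl | rfl) (rfl | rfl) (rfl | rfl) (rfl | rfl) <;> norm_num
  · convert key 1 1 (-1) 1 2 ?_ using 2
    · ring
    · rintro _ _ _ _ (rfl | rfl) (rfl | rfl) (rfl | rfl) (rfl | rfl) <;> norm_num
  · convert key 1 1 1 (-1) 2 ?_ using 2
    · ring
    · rintro _ _ _ _ (rfl | rfl) (rfl | rfl) (rfl | rfl) (rfl | rfl) <;> norm_num

/-- A convex set containing the points `± v k` contains the cross-polytope that they span. -/
lemma sum_smul_mem_of_neg_mem {E ι : Type*} [AddCommGroup E] [Module ℝ E] [Fintype ι]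
    [Nonempty ι] {s : Set E} (hs : Convex ℝ s) {v : ι → E} (hv : ∀ k, v k ∈ s)
    (hv' : ∀ k, -v k ∈ s) {t : ι → ℝ} (ht : ∑ k, |t k| ≤ 1) : ∑ k, t k • v k ∈ s := by
  have h0 : (0 : E) ∈ s := by
    obtain ⟨k⟩ := ‹Nonempty ι›
    have := hs (hv k) (hv' k) (a := 1 / 2) (b := 1 / 2) (by norm_num) (by norm_num) (by norm_num)
    simpa using this
  have hz : ∀ k, ∃ z ∈ s, |t k| • z = t k • v k := by
    intro k
    rcases abs_cases (t k) with ⟨h, -⟩ | ⟨h, -⟩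
    · exact ⟨v k, hv k, by rw [h]⟩
    · exact ⟨-v k, hv' k, by rw [h, smul_neg, neg_smul, neg_neg]⟩
  choose z hz hzt using hz
  -- The remaining weight goes to the origin.
  have := hs.sum_mem (t := Finset.univ) (w := fun o : Option ι => o.elim (1 - ∑ k, |t k|)
    (fun k => |t k|)) (z := fun o => o.elim 0 z) ?_ ?_ ?_
  · simpa [Fintype.sum_option, hzt] using this
  · rintro (_ | k) -
    · exact sub_nonneg.2 ht
    · exact abs_nonneg _
  · simp [Fintype.sum_option]
  · rintro (_ | k) -
    exacts [h0, hz k]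

/-- Of the sixteen sign choices, the even ones give ±4xᵢ and the odd ones give twice an odd facet
functional. -/
lemma IsDemicubePoint.sum_abs_le {x₁ x₂ x₃ x₄ : ℝ} (hx : IsDemicubePoint x₁ x₂ x₃ x₄) :
    |x₁ + x₂ + x₃ + x₄| + |x₁ + x₂ - x₃ - x₄| + |x₁ - x₂ + x₃ - x₄| +
      |x₁ - x₂ - x₃ + x₄| ≤ 4 := by
  obtain ⟨a₁, a₂, a₃, a₄, f₁, f₂, f₃, f₄⟩ := hx
  rw [abs_le] at a₁ a₂ a₃ a₄ f₁ f₂ f₃ f₄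
  rcases abs_cases (x₁ + x₂ + x₃ + x₄) with ⟨h₁, -⟩ | ⟨h₁, -⟩ <;>
  rcases abs_cases (x₁ + x₂ - x₃ - x₄) with ⟨h₂, -⟩ | ⟨h₂, -⟩ <;>
  rcases abs_cases (x₁ - x₂ + x₃ - x₄) with ⟨h₃, -⟩ | ⟨h₃, -⟩ <;>
  rcases abs_cases (x₁ - x₂ - x₃ + x₄) with ⟨h₄, -⟩ | ⟨h₄, -⟩ <;>
  rw [h₁, h₂, h₃, h₄] <;> linarith

/-- The demicube is a cross-polytope: its vertices are ± four orthogonal vectors, and the quarter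
sums are the coordinates in that basis. -/
lemma point_mem_demicube {x₁ x₂ x₃ x₄ : ℝ} (hx : IsDemicubePoint x₁ x₂ x₃ x₄) :
    point x₁ x₂ x₃ x₄ ∈ demicube := by
  have hs : ∀ y₁ y₂ y₃ y₄ : ℝ, (y₁ = 1 ∨ y₁ = -1) → (y₂ = 1 ∨ y₂ = -1) →
      (y₃ = 1 ∨ y₃ = -1) → (y₄ = 1 ∨ y₄ = -1) → y₁ * y₂ * (y₃ * y₄) = 1 →
      point y₁ y₂ y₃ y₄ ∈ demicube := by
    intro y₁ y₂ y₃ y₄ h₁ h₂ h₃ h₄ h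
    refine subset_convexHull ℝ _ ⟨?_, ?_⟩
    · simp [Fin.forall_fin_two, point, h₁, h₂, h₃, h₄]
    · simpa [point, Fin.prod_univ_two] using h
  have key := sum_smul_mem_of_neg_mem (s := demicube) (convex_convexHull ℝ evenVertices)
    (v := ![point 1 1 1 1, point 1 1 (-1) (-1), point 1 (-1) 1 (-1), point 1 (-1) (-1) 1])
    (t := ![(x₁ + x₂ + x₃ + x₄) / 4, (x₁ + x₂ - x₃ - x₄) / 4, (x₁ - x₂ + x₃ - x₄) / 4,
      (x₁ - x₂ - x₃ + x₄) / 4]) ?_ ?_ ?_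
  · convert key using 1
    ext i j
    fin_cases i <;> fin_cases j <;> simp [point, Fin.sum_univ_four] <;> ring
  · intro k
    fin_cases k <;> refine hs _ _ _ _ ?_ ?_ ?_ ?_ ?_ <;> norm_num
  · have hn : ∀ y₁ y₂ y₃ y₄ : ℝ, -point y₁ y₂ y₃ y₄ = point (-y₁) (-y₂) (-y₃) (-y₄) := by
      intros; simp [point]
    intro k
    fin_cases k <;> simp only [Fin.reduceFinMk, Matrix.cons_val, Fin.zero_eta, Fin.mk_one, hn] <;>
      refine hs _ _ _ _ ?_ ?_ ?_ ?_ ?_ <;> norm_num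
  · have := hx.sum_abs_le
    simp only [Fin.sum_univ_four, Matrix.cons_val, abs_div, Nat.abs_ofNat]
    linarith

lemma mem_demicube_iff (x : R4) :
    x ∈ demicube ↔ IsDemicubePoint (x 0 0) (x 0 1) (x 1 0) (x 1 1) :=
  ⟨isDemicubePoint_of_mem_demicube, fun h => by rw [eq_point x]; exact point_mem_demicube h⟩

/-! ### Spherical triangles -/

lemma abs_cos_le_iff {a b : ℝ} (ha : |a| ≤ Real.pi) (hb : |b| ≤ Real.pi) :
    Real.cos a ≤ Real.cos b ↔ |b| ≤ |a| := by
  rw [← Real.cos_abs a, ← Real.cos_abs b]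
  exact Real.strictAntiOn_cos.le_iff_ge ⟨abs_nonneg a, ha⟩ ⟨abs_nonneg b, hb⟩

/-- The spherical triangle inequalities. -/
lemma gramDet_cos_nonneg_iff {φ a b : ℝ} (hφ : φ ∈ Set.Icc 0 Real.pi)
    (ha : a ∈ Set.Icc 0 Real.pi) (hb : b ∈ Set.Icc 0 Real.pi) :
    0 ≤ gramDet (Real.cos φ) (Real.cos a) (Real.cos b) ↔
      |a - b| ≤ φ ∧ φ ≤ a + b ∧ φ ≤ 2 * Real.pi - (a + b) := by
  obtain ⟨hφ₀, hφ₁⟩ := hφ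
  obtain ⟨ha₀, ha₁⟩ := ha
  obtain ⟨hb₀, hb₁⟩ := hb
  -- The factorization reduces the claim to cos (a + b) ≤ cos φ ≤ cos (a - b).
  have hD : gramDet (Real.cos φ) (Real.cos a) (Real.cos b) =
      (Real.cos φ - Real.cos (a + b)) * (Real.cos (a - b) - Real.cos φ) := by
    rw [gramDet_eq, Real.cos_add, Real.cos_sub, ← Real.sin_sq, ← Real.sin_sq]; ring
  have h₁ : Real.cos φ ≤ Real.cos (a - b) ↔ |a - b| ≤ φ := by
    rw [abs_cos_le_iff (by rwa [abs_of_nonneg hφ₀]) (abs_le.2 ⟨by linarith, by linarith⟩),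
      abs_of_nonneg hφ₀]
  have h₂ : Real.cos (a + b) ≤ Real.cos φ ↔ φ ≤ a + b ∧ φ ≤ 2 * Real.pi - (a + b) := by
    rcases le_total (a + b) Real.pi with h | h
    · rw [abs_cos_le_iff (abs_le.2 ⟨by linarith, h⟩) (by rwa [abs_of_nonneg hφ₀]),
        abs_of_nonneg hφ₀, abs_of_nonneg (by linarith)]
      exact ⟨fun h' => ⟨h', by linarith⟩, fun h' => h'.1⟩
    · rw [← Real.cos_two_pi_sub (a + b), abs_cos_le_iff
        (abs_le.2 ⟨by linarith, by linarith⟩) (by rwa [abs_of_nonneg hφ₀]),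
        abs_of_nonneg hφ₀, abs_of_nonneg (by linarith)]
      exact ⟨fun h' => ⟨by linarith, h'⟩, fun h' => h'.2⟩
  have h₃ : Real.cos (a + b) ≤ Real.cos (a - b) := by
    rw [Real.cos_add, Real.cos_sub]
    linarith [mul_nonneg (Real.sin_nonneg_of_nonneg_of_le_pi ha₀ ha₁)
      (Real.sin_nonneg_of_nonneg_of_le_pi hb₀ hb₁)]
  rw [← h₁, ← h₂, hD]
  constructor
  · intro h
    rcases mul_nonneg_iff.1 h with h | h
    · exact ⟨sub_nonneg.1 h.2, sub_nonneg.1 h.1⟩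
    -- Both factors nonpositive, together with `h₃`, forces equality throughout.
    · have : Real.cos φ = Real.cos (a + b) ∧ Real.cos φ = Real.cos (a - b) := by
        constructor <;> linarith [h.1, h.2]
      exact ⟨this.2.le, this.1.ge⟩
  · rintro ⟨h, h'⟩
    exact mul_nonneg (sub_nonneg.2 h') (sub_nonneg.2 h)

/-- Two spherical triangles with sides `a, c` and `b, d` fit together along a common third side. -/
lemma exists_gramDet_cos_iff {a b c d : ℝ}
    (ha : a ∈ Set.Icc 0 Real.pi) (hb : b ∈ Set.Icc 0 Real.pi) (hc : c ∈ Set.Icc 0 Real.pi)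
    (hd : d ∈ Set.Icc 0 Real.pi) :
    (∃ u : ℝ, u ^ 2 ≤ 1 ∧ 0 ≤ gramDet u (Real.cos a) (Real.cos c) ∧
      0 ≤ gramDet u (Real.cos b) (Real.cos d)) ↔
    (|a - c| ≤ b + d ∧ |a - c| ≤ 2 * Real.pi - (b + d)) ∧
      |b - d| ≤ a + c ∧ |b - d| ≤ 2 * Real.pi - (a + c) := by
  constructor
  · rintro ⟨u, hu, h₁, h₂⟩
    have hu' := abs_le.1 ((sq_le_one_iff_abs_le_one u).1 hu)
    have hφ : Real.arccos u ∈ Set.Icc 0 Real.pi := ⟨Real.arccos_nonneg u, Real.arccos_le_pi u⟩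
    rw [← Real.cos_arccos hu'.1 hu'.2] at h₁ h₂
    rw [gramDet_cos_nonneg_iff hφ ha hc] at h₁
    rw [gramDet_cos_nonneg_iff hφ hb hd] at h₂
    refine ⟨⟨?_, ?_⟩, ?_, ?_⟩ <;> linarith [h₁.1, h₁.2.1, h₁.2.2, h₂.1, h₂.2.1, h₂.2.2]
  · rintro ⟨⟨h₁, h₂⟩, h₃, h₄⟩
    obtain ⟨ha₀, ha₁⟩ := ha
    obtain ⟨hb₀, hb₁⟩ := hb
    obtain ⟨hc₀, hc₁⟩ := hc
    obtain ⟨hd₀, hd₁⟩ := hd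
    have e₁ : |a - c| ≤ a + c ∧ |a - c| ≤ 2 * Real.pi - (a + c) ∧ |a - c| ≤ Real.pi := by
      simp only [abs_le]; refine ⟨⟨?_, ?_⟩, ⟨?_, ?_⟩, ?_, ?_⟩ <;> linarith
    have e₂ : |b - d| ≤ b + d ∧ |b - d| ≤ 2 * Real.pi - (b + d) ∧ |b - d| ≤ Real.pi := by
      simp only [abs_le]; refine ⟨⟨?_, ?_⟩, ⟨?_, ?_⟩, ?_, ?_⟩ <;> linarith
    -- The larger of the two lower bounds serves as the common side; the bounds within a single
    -- triangle hold automatically.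
    have hφ : max |a - c| |b - d| ∈ Set.Icc 0 Real.pi :=
      ⟨(abs_nonneg _).trans (le_max_left _ _), max_le e₁.2.2 e₂.2.2⟩
    refine ⟨Real.cos (max |a - c| |b - d|), Real.cos_sq_le_one _, ?_, ?_⟩
    · rw [gramDet_cos_nonneg_iff hφ ⟨ha₀, ha₁⟩ ⟨hc₀, hc₁⟩]
      exact ⟨le_max_left _ _, max_le e₁.1 h₃, max_le e₁.2.1 h₄⟩
    · rw [gramDet_cos_nonneg_iff hφ ⟨hb₀, hb₁⟩ ⟨hd₀, hd₁⟩]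
      exact ⟨le_max_right _ _, max_le h₁ e₂.1, max_le h₂ e₂.2.1⟩

/-! ### The sine map and the demicube -/

lemma sin_eq_cos_angle (x : ℝ) :
    Real.sin (Real.pi / 2 * x) = Real.cos (Real.pi / 2 * (1 - x)) := by
  rw [← Real.cos_pi_div_two_sub]; ring_nf

lemma angle_mem_Icc {x : ℝ} (hx : |x| ≤ 1) :
    Real.pi / 2 * (1 - x) ∈ Set.Icc 0 Real.pi := by
  have := abs_le.1 hx
  have := Real.pi_pos
  constructor <;> nlinarith

/-- Unfolding the absolute values turns the four conditions into the eight odd facets. It is applied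
with r = π/2. -/
lemma isDemicubePoint_iff_angles {x₁ x₂ x₃ x₄ : ℝ} (h₁ : |x₁| ≤ 1) (h₂ : |x₂| ≤ 1)
    (h₃ : |x₃| ≤ 1) (h₄ : |x₄| ≤ 1) {r : ℝ} (hr : 0 < r) :
    IsDemicubePoint x₁ x₂ x₃ x₄ ↔
    (|r * (1 - x₁) - r * (1 - x₃)| ≤ r * (1 - x₂) + r * (1 - x₄) ∧
      |r * (1 - x₁) - r * (1 - x₃)| ≤ 4 * r - (r * (1 - x₂) + r * (1 - x₄))) ∧
      |r * (1 - x₂) - r * (1 - x₄)| ≤ r * (1 - x₁) + r * (1 - x₃) ∧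
      |r * (1 - x₂) - r * (1 - x₄)| ≤ 4 * r - (r * (1 - x₁) + r * (1 - x₃)) := by
  have e₁ : |r * (1 - x₁) - r * (1 - x₃)| = r * |x₃ - x₁| := by
    rw [← abs_of_pos hr, ← abs_mul, abs_of_pos hr]; ring_nf
  have e₂ : |r * (1 - x₂) - r * (1 - x₄)| = r * |x₄ - x₂| := by
    rw [← abs_of_pos hr, ← abs_mul, abs_of_pos hr]; ring_nf
  rw [e₁, e₂, show r * (1 - x₂) + r * (1 - x₄) = r * (2 - x₂ - x₄) by ring,
    show r * (1 - x₁) + r * (1 - x₃) = r * (2 - x₁ - x₃) by ring,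
    show 4 * r - r * (2 - x₂ - x₄) = r * (2 + x₂ + x₄) by ring,
    show 4 * r - r * (2 - x₁ - x₃) = r * (2 + x₁ + x₃) by ring]
  simp only [mul_le_mul_iff_right₀ hr, abs_le]
  constructor
  · rintro ⟨-, -, -, -, f₁, f₂, f₃, f₄⟩
    rw [abs_le] at f₁ f₂ f₃ f₄
    refine ⟨⟨⟨?_, ?_⟩, ?_, ?_⟩, ⟨?_, ?_⟩, ?_, ?_⟩ <;> linarith
  · rintro ⟨⟨⟨_, _⟩, _, _⟩, ⟨_, _⟩, _, _⟩
    refine ⟨h₁, h₂, h₃, h₄, ?_, ?_, ?_, ?_⟩ <;> rw [abs_le] <;> constructor <;> linarith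

lemma mem_cube_iff_abs {c : R4} : c ∈ cube ↔ ∀ i j, |c i j| ≤ 1 := by
  simp [cube, abs_le]

lemma pushout_mem_cube (x : R4) : pushout x ∈ cube :=
  fun _ _ => ⟨Real.neg_one_le_sin _, Real.sin_le_one _⟩

lemma pushout_mem_chordalSet_iff {x : R4} (hx : x ∈ cube) :
    pushout x ∈ chordalSet ↔ x ∈ demicube := by
  rw [mem_cube_iff_abs] at hx
  rw [mem_demicube_iff, isDemicubePoint_iff_angles (hx 0 0) (hx 0 1) (hx 1 0) (hx 1 1)
    (half_pos Real.pi_pos), show 4 * (Real.pi / 2) = 2 * Real.pi by ring,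
    ← exists_gramDet_cos_iff (angle_mem_Icc (hx 0 0)) (angle_mem_Icc (hx 0 1))
      (angle_mem_Icc (hx 1 0)) (angle_mem_Icc (hx 1 1))]
  simp only [chordalSet, Set.mem_ofPred_eq, pushout_mem_cube, true_and, pushout, sin_eq_cos_angle]

/-- The coordinatewise map `c ↦ (2 / π) arcsin c`. -/
noncomputable def pushoutInv (c : R4) : R4 := fun i j => 2 / Real.pi * Real.arcsin (c i j)

lemma pushoutInv_mem_cube (c : R4) : pushoutInv c ∈ cube := by
  intro i j
  have h₁ := Real.neg_pi_div_two_le_arcsin (c i j)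
  have h₂ := Real.arcsin_le_pi_div_two (c i j)
  have := Real.pi_pos
  simp only [pushoutInv]
  constructor
  · rw [div_mul_eq_mul_div, le_div_iff₀ this]; linarith
  · rw [div_mul_eq_mul_div, div_le_iff₀ this]; linarith

lemma pushout_pushoutInv {c : R4} (hc : c ∈ cube) : pushout (pushoutInv c) = c := by
  ext i j
  have := Real.pi_ne_zero
  simp only [pushout, pushoutInv]
  rw [show Real.pi / 2 * (2 / Real.pi * Real.arcsin (c i j)) = Real.arcsin (c i j) by field_simp]
  exact Real.sin_arcsin (hc i j).1 (hc i j).2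

lemma pushoutInv_pushout {c : R4} (hc : c ∈ cube) : pushoutInv (pushout c) = c := by
  ext i j
  have := Real.pi_pos
  have h := hc i j
  simp only [pushout, pushoutInv]
  rw [Real.arcsin_sin (by nlinarith) (by nlinarith)]
  field_simp

/-- The map `pushout` is a homeomorphism of the cube onto itself. -/
noncomputable def pushoutHomeomorph : cube ≃ₜ cube where
  toFun c := ⟨pushout c, pushout_mem_cube c⟩
  invFun c := ⟨pushoutInv c, pushoutInv_mem_cube c⟩
  left_inv c := Subtype.ext (pushoutInv_pushout c.2)
  right_inv c := Subtype.ext (pushout_pushoutInv c.2)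
  continuous_toFun := by
    refine Continuous.subtype_mk ?_ _
    exact continuous_pi fun i => continuous_pi fun j => Real.continuous_sin.comp
      (continuous_const.mul ((continuous_apply_apply i j).comp
        continuous_subtype_val))
  continuous_invFun := by
    refine Continuous.subtype_mk ?_ _
    exact continuous_pi fun i => continuous_pi fun j => continuous_const.mul
      (Real.continuous_arcsin.comp ((continuous_apply_apply i j).comp
        continuous_subtype_val))

lemma IsDemicubePoint.mem_cube {x : R4}
    (h : IsDemicubePoint (x 0 0) (x 0 1) (x 1 0) (x 1 1)) : x ∈ cube := by
  rw [mem_cube_iff_abs]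
  simp [Fin.forall_fin_two, h.coord₁, h.coord₂, h.coord₃, h.coord₄]

lemma pushout_image_demicube : pushout '' demicube = chordalSet := by
  ext c
  constructor
  · rintro ⟨x, hx, rfl⟩
    exact (pushout_mem_chordalSet_iff (isDemicubePoint_of_mem_demicube hx).mem_cube).2 hx
  · intro hc
    have h := pushout_pushoutInv hc.1
    refine ⟨pushoutInv c, ?_, h⟩
    rw [← pushout_mem_chordalSet_iff (pushoutInv_mem_cube c), h]
    exact hc

/-! ### The demicube maps into the hull of the cosine surface -/

/-- The point lies on a facet of the demicube given by an odd sign vector. -/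
def IsTight (x₁ x₂ x₃ x₄ : ℝ) : Prop :=
  |-x₁ + x₂ + x₃ + x₄| = 2 ∨ |x₁ - x₂ + x₃ + x₄| = 2 ∨ |x₁ + x₂ - x₃ + x₄| = 2 ∨
    |x₁ + x₂ + x₃ - x₄| = 2

lemma IsDemicubePoint.exists_above {x₁ x₂ x₃ x₄ : ℝ} (h : IsDemicubePoint x₁ x₂ x₃ x₄) :
    ∃ y, x₁ ≤ y ∧ IsDemicubePoint y x₂ x₃ x₄ ∧ (IsTight y x₂ x₃ x₄ ∨ y = 1) := by
  obtain ⟨a₁, a₂, a₃, a₄, f₁, f₂, f₃, f₄⟩ := h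
  obtain ⟨y, h₀, h₁, h₂, h₃, h₄, hy⟩ : ∃ y, y ≤ 1 ∧ y ≤ 2 + (x₂ + x₃ + x₄) ∧
      y ≤ 2 - (-x₂ + x₃ + x₄) ∧ y ≤ 2 - (x₂ - x₃ + x₄) ∧ y ≤ 2 - (x₂ + x₃ - x₄) ∧
      (y = 1 ∨ y = 2 + (x₂ + x₃ + x₄) ∨ y = 2 - (-x₂ + x₃ + x₄) ∨ y = 2 - (x₂ - x₃ + x₄) ∨
        y = 2 - (x₂ + x₃ - x₄)) := by
    -- These are all the upper bounds on the first coordinate; the lower bounds persist because it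
    -- only increases.
    refine ⟨min 1 (min (2 + (x₂ + x₃ + x₄)) (min (2 - (-x₂ + x₃ + x₄))
      (min (2 - (x₂ - x₃ + x₄)) (2 - (x₂ + x₃ - x₄))))), by simp, by simp, by simp, by simp,
      by simp, ?_⟩
    grind
  rw [abs_le] at a₁ f₁ f₂ f₃ f₄
  have hxy : x₁ ≤ y := by
    rcases hy with hy | hy | hy | hy | hy <;> linarith
  refine ⟨y, hxy, ⟨?_, a₂, a₃, a₄, ?_, ?_, ?_, ?_⟩, ?_⟩
  · rw [abs_le]; constructor <;> linarith
  · rw [abs_le]; constructor <;> linarith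
  · rw [abs_le]; constructor <;> linarith
  · rw [abs_le]; constructor <;> linarith
  · rw [abs_le]; constructor <;> linarith
  · unfold IsTight
    simp only [abs_eq (zero_le_two : (0 : ℝ) ≤ 2)]
    rcases hy with hy | hy | hy | hy | hy
    · exact Or.inr hy
    · exact Or.inl (Or.inl (Or.inr (by linarith)))
    · exact Or.inl (Or.inr (Or.inl (Or.inl (by linarith))))
    · exact Or.inl (Or.inr (Or.inr (Or.inl (Or.inl (by linarith)))))
    · exact Or.inl (Or.inr (Or.inr (Or.inr (Or.inl (by linarith)))))

lemma IsDemicubePoint.neg {x₁ x₂ x₃ x₄ : ℝ} (h : IsDemicubePoint x₁ x₂ x₃ x₄) :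
    IsDemicubePoint (-x₁) (-x₂) (-x₃) (-x₄) := by
  obtain ⟨a₁, a₂, a₃, a₄, f₁, f₂, f₃, f₄⟩ := h
  rw [abs_le] at f₁ f₂ f₃ f₄
  refine ⟨by simpa, by simpa, by simpa, by simpa, ?_, ?_, ?_, ?_⟩ <;> rw [abs_le] <;>
    constructor <;> linarith

lemma isTight_neg {x₁ x₂ x₃ x₄ : ℝ} (h : IsTight (-x₁) (-x₂) (-x₃) (-x₄)) :
    IsTight x₁ x₂ x₃ x₄ := by
  unfold IsTight at *
  rw [← abs_neg (-x₁ + x₂ + x₃ + x₄), ← abs_neg (x₁ - x₂ + x₃ + x₄),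
    ← abs_neg (x₁ + x₂ - x₃ + x₄), ← abs_neg (x₁ + x₂ + x₃ - x₄)]
  convert h using 3 <;> ring_nf

lemma IsDemicubePoint.exists_below {x₁ x₂ x₃ x₄ : ℝ} (h : IsDemicubePoint x₁ x₂ x₃ x₄) :
    ∃ y, y ≤ x₁ ∧ IsDemicubePoint y x₂ x₃ x₄ ∧ (IsTight y x₂ x₃ x₄ ∨ y = -1) := by
  obtain ⟨y, hy, hP, hT⟩ := h.neg.exists_above
  refine ⟨-y, by linarith, by simpa using hP.neg, hT.imp (fun hT => ?_) (fun hT => by rw [hT])⟩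
  exact isTight_neg (by simpa using hT)

/-- A set closed under convex combinations along the first coordinate contains a demicube point as
soon as it contains the tight points and the points with first coordinate `± 1` on its line. -/
lemma IsDemicubePoint.induction_coord {p : ℝ → Prop} {x₁ x₂ x₃ x₄ : ℝ}
    (h : IsDemicubePoint x₁ x₂ x₃ x₄)
    (hconv : ∀ y z w, p y → p z → |y| ≤ 1 → |z| ≤ 1 → y ≤ w → w ≤ z → p w)
    (ht : ∀ y, IsTight y x₂ x₃ x₄ → IsDemicubePoint y x₂ x₃ x₄ → p y)
    (hv : ∀ y, y ^ 2 = 1 → IsDemicubePoint y x₂ x₃ x₄ → p y) : p x₁ := by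
  obtain ⟨y, hy, hyP, hyT⟩ := h.exists_below
  obtain ⟨z, hz, hzP, hzT⟩ := h.exists_above
  refine hconv y z x₁ ?_ ?_ hyP.coord₁ hzP.coord₁ hy hz
  · rcases hyT with hyT | hyT
    exacts [ht _ hyT hyP, hv _ (by rw [hyT]; norm_num) hyP]
  · rcases hzT with hzT | hzT
    exacts [ht _ hzT hzP, hv _ (by rw [hzT]; norm_num) hzP]

/-- Cyclic symmetry lets the argument for the first coordinate serve all four. -/
lemma IsDemicubePoint.rotate {x₁ x₂ x₃ x₄ : ℝ} (h : IsDemicubePoint x₁ x₂ x₃ x₄) :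
    IsDemicubePoint x₂ x₃ x₄ x₁ := by
  obtain ⟨a₁, a₂, a₃, a₄, f₁, f₂, f₃, f₄⟩ := h
  rw [abs_le] at f₁ f₂ f₃ f₄
  refine ⟨a₂, a₃, a₄, a₁, ?_, ?_, ?_, ?_⟩ <;> rw [abs_le] <;> constructor <;> linarith

lemma IsTight.rotate {x₁ x₂ x₃ x₄ : ℝ} (h : IsTight x₁ x₂ x₃ x₄) : IsTight x₂ x₃ x₄ x₁ := by
  unfold IsTight at *
  rcases h with h | h | h | h
  · exact Or.inr (Or.inr (Or.inr (by rw [← h]; ring_nf)))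
  · exact Or.inl (by rw [← h]; ring_nf)
  · exact Or.inr (Or.inl (by rw [← h]; ring_nf))
  · exact Or.inr (Or.inr (Or.inl (by rw [← h]; ring_nf)))

/-- The value of `pushout` at the point with the given coordinates. -/
noncomputable def sinPoint (x₁ x₂ x₃ x₄ : ℝ) : R4 :=
  point (Real.sin (Real.pi / 2 * x₁)) (Real.sin (Real.pi / 2 * x₂)) (Real.sin (Real.pi / 2 * x₃))
    (Real.sin (Real.pi / 2 * x₄))

/-- Cosine is even, so each angle π/2 (1 - xᵢ) may be given any sign before summing. -/
lemma sinPoint_mem_cosineSurface {x₁ x₂ x₃ x₄ : ℝ} {s₁ s₂ s₃ s₄ : ℤˣ} {k : ℤ}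
    (h : (s₁ : ℤ) * (1 - x₁) + (s₂ : ℤ) * (1 - x₂) + (s₃ : ℤ) * (1 - x₃) +
      (s₄ : ℤ) * (1 - x₄) = 4 * k) :
    sinPoint x₁ x₂ x₃ x₄ ∈ cosineSurface := by
  have hc : ∀ (s : ℤˣ) (x : ℝ), Real.sin (Real.pi / 2 * x) =
      Real.cos ((s : ℤ) * (Real.pi / 2 * (1 - x))) := by
    intro s x
    rw [sin_eq_cos_angle]
    rcases Int.units_eq_one_or s with rfl | rfl <;> simp
  exact ⟨(s₁ : ℤ) * (Real.pi / 2 * (1 - x₁)), (s₂ : ℤ) * (Real.pi / 2 * (1 - x₂)),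
    (s₃ : ℤ) * (Real.pi / 2 * (1 - x₃)), (s₄ : ℤ) * (Real.pi / 2 * (1 - x₄)), ⟨k, by linear_combination (Real.pi / 2) * h⟩,
    by rw [sinPoint, hc s₁, hc s₂, hc s₃, hc s₄]⟩

lemma IsTight.sinPoint_mem {x₁ x₂ x₃ x₄ : ℝ} (h : IsTight x₁ x₂ x₃ x₄) :
    sinPoint x₁ x₂ x₃ x₄ ∈ cosineSurface := by
  unfold IsTight at h
  simp only [abs_eq (zero_le_two : (0 : ℝ) ≤ 2)] at h
  rcases h with (h | h) | (h | h) | (h | h) | (h | h)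
  · refine sinPoint_mem_cosineSurface (s₁ := -1) (s₂ := 1) (s₃ := 1) (s₄ := 1) (k := 0) ?_
    push_cast; linarith
  · refine sinPoint_mem_cosineSurface (s₁ := -1) (s₂ := 1) (s₃ := 1) (s₄ := 1) (k := 1) ?_
    push_cast; linarith
  · refine sinPoint_mem_cosineSurface (s₁ := 1) (s₂ := -1) (s₃ := 1) (s₄ := 1) (k := 0) ?_
    push_cast; linarith
  · refine sinPoint_mem_cosineSurface (s₁ := 1) (s₂ := -1) (s₃ := 1) (s₄ := 1) (k := 1) ?_
    push_cast; linarith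
  · refine sinPoint_mem_cosineSurface (s₁ := 1) (s₂ := 1) (s₃ := -1) (s₄ := 1) (k := 0) ?_
    push_cast; linarith
  · refine sinPoint_mem_cosineSurface (s₁ := 1) (s₂ := 1) (s₃ := -1) (s₄ := 1) (k := 1) ?_
    push_cast; linarith
  · refine sinPoint_mem_cosineSurface (s₁ := 1) (s₂ := 1) (s₃ := 1) (s₄ := -1) (k := 0) ?_
    push_cast; linarith
  · refine sinPoint_mem_cosineSurface (s₁ := 1) (s₂ := 1) (s₃ := 1) (s₄ := -1) (k := 1) ?_
    push_cast; linarith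

lemma IsDemicubePoint.sinPoint_mem_of_vertex {x₁ x₂ x₃ x₄ : ℝ}
    (h : IsDemicubePoint x₁ x₂ x₃ x₄) (h₁ : x₁ ^ 2 = 1) (h₂ : x₂ ^ 2 = 1) (h₃ : x₃ ^ 2 = 1)
    (h₄ : x₄ ^ 2 = 1) : sinPoint x₁ x₂ x₃ x₄ ∈ cosineSurface := by
  obtain ⟨k, hk⟩ : ∃ k : ℤ, 4 - (x₁ + x₂ + x₃ + x₄) = 4 * k := by
    obtain ⟨-, -, -, -, f₁, f₂, f₃, f₄⟩ := h
    rw [abs_le] at f₁ f₂ f₃ f₄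
    rw [sq_eq_one_iff] at h₁ h₂ h₃ h₄
    rcases h₁ with rfl | rfl <;> rcases h₂ with rfl | rfl <;> rcases h₃ with rfl | rfl <;>
      rcases h₄ with rfl | rfl <;>
      -- Odd sign vectors violate a facet; 0, 2 or 4 minus signs give k = 0, 1, 2.
      first
      | (exfalso; linarith)
      | (refine ⟨0, ?_⟩; norm_num; done)
      | (refine ⟨1, ?_⟩; norm_num; done)
      | (refine ⟨2, ?_⟩; norm_num)
  refine sinPoint_mem_cosineSurface (s₁ := 1) (s₂ := 1) (s₃ := 1) (s₄ := 1) (k := k) ?_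
  push_cast
  linarith

/-- Sine is monotone on [-π/2, π/2], so intermediate arguments have intermediate values. -/
lemma exists_convex_combination_sin {y z w : ℝ} (hy : |y| ≤ 1) (hz : |z| ≤ 1) (hyw : y ≤ w)
    (hwz : w ≤ z) : ∃ a b : ℝ, 0 ≤ a ∧ 0 ≤ b ∧ a + b = 1 ∧
      Real.sin (Real.pi / 2 * w) =
        a * Real.sin (Real.pi / 2 * y) + b * Real.sin (Real.pi / 2 * z) := by
  have hπ := Real.pi_pos
  rw [abs_le] at hy hz
  have h₁ : Real.sin (Real.pi / 2 * y) ≤ Real.sin (Real.pi / 2 * w) :=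
    Real.sin_le_sin_of_le_of_le_pi_div_two (by nlinarith) (by nlinarith) (by nlinarith)
  have h₂ : Real.sin (Real.pi / 2 * w) ≤ Real.sin (Real.pi / 2 * z) :=
    Real.sin_le_sin_of_le_of_le_pi_div_two (by nlinarith) (by nlinarith) (by nlinarith)
  have h : Real.sin (Real.pi / 2 * w) ∈
      segment ℝ (Real.sin (Real.pi / 2 * y)) (Real.sin (Real.pi / 2 * z)) := by
    rw [segment_eq_Icc (h₁.trans h₂)]
    exact ⟨h₁, h₂⟩
  obtain ⟨a, b, ha, hb, hab, h⟩ := h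
  exact ⟨a, b, ha, hb, hab, by simpa using h.symm⟩

lemma sinPoint_mem_of_convex {s : Set R4} (hs : Convex ℝ s) {i : Fin 4} {x : Fin 4 → ℝ}
    {y z w : ℝ} (hy : |y| ≤ 1) (hz : |z| ≤ 1) (hyw : y ≤ w) (hwz : w ≤ z)
    {f : ℝ → R4} (hf : ∀ t, f t = sinPoint (Function.update x i t 0) (Function.update x i t 1)
      (Function.update x i t 2) (Function.update x i t 3))
    (h₁ : f y ∈ s) (h₂ : f z ∈ s) : f w ∈ s := by
  obtain ⟨a, b, ha, hb, hab, h⟩ := exists_convex_combination_sin hy hz hyw hwz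
  convert hs h₁ h₂ ha hb hab using 1
  have key : ∀ r : ℝ, a * r + b * r = r := fun r => by rw [← add_mul, hab, one_mul]
  rw [hf, hf, hf]
  ext j k
  fin_cases i <;> fin_cases j <;> fin_cases k <;> simp [sinPoint, point, key, h]

/-- Each coordinate in turn is moved both ways until an odd facet is met or it becomes ±1; if no
facet intervenes, a vertex is reached. -/
lemma IsDemicubePoint.sinPoint_mem {x₁ x₂ x₃ x₄ : ℝ} (h : IsDemicubePoint x₁ x₂ x₃ x₄) :
    sinPoint x₁ x₂ x₃ x₄ ∈ convexHull ℝ cosineSurface := by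
  have hc := convex_convexHull ℝ cosineSurface
  have hsub := subset_convexHull ℝ cosineSurface
  refine h.induction_coord (p := fun y => sinPoint y x₂ x₃ x₄ ∈ convexHull ℝ cosineSurface)
    (fun y z w py pz hy hz hyw hwz => sinPoint_mem_of_convex hc (i := 0) (x := ![0, x₂, x₃, x₄])
      (f := fun y => sinPoint y x₂ x₃ x₄) hy hz hyw hwz (by simp) py pz)
    (fun y ht _ => hsub ht.sinPoint_mem) fun y₁ hy₁ h => ?_
  refine h.rotate.induction_coord
    (p := fun y => sinPoint y₁ y x₃ x₄ ∈ convexHull ℝ cosineSurface)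
    (fun y z w py pz hy hz hyw hwz => sinPoint_mem_of_convex hc (i := 1) (x := ![y₁, 0, x₃, x₄])
      (f := fun y => sinPoint y₁ y x₃ x₄) hy hz hyw hwz (by simp) py pz)
    (fun y ht _ => hsub ht.rotate.rotate.rotate.sinPoint_mem) fun y₂ hy₂ h => ?_
  refine h.rotate.induction_coord
    (p := fun y => sinPoint y₁ y₂ y x₄ ∈ convexHull ℝ cosineSurface)
    (fun y z w py pz hy hz hyw hwz => sinPoint_mem_of_convex hc (i := 2) (x := ![y₁, y₂, 0, x₄])
      (f := fun y => sinPoint y₁ y₂ y x₄) hy hz hyw hwz (by simp) py pz)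
    (fun y ht _ => hsub ht.rotate.rotate.sinPoint_mem) fun y₃ hy₃ h => ?_
  refine h.rotate.induction_coord
    (p := fun y => sinPoint y₁ y₂ y₃ y ∈ convexHull ℝ cosineSurface)
    (fun y z w py pz hy hz hyw hwz => sinPoint_mem_of_convex hc (i := 3) (x := ![y₁, y₂, y₃, 0])
      (f := fun y => sinPoint y₁ y₂ y₃ y) hy hz hyw hwz (by simp) py pz)
    (fun y ht _ => hsub ht.rotate.sinPoint_mem) fun y₄ hy₄ h => ?_
  exact hsub (h.rotate.sinPoint_mem_of_vertex hy₁ hy₂ hy₃ hy₄)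

lemma convexHull_cosineSurface_eq_chordalSet : convexHull ℝ cosineSurface = chordalSet := by
  refine convexHull_cosineSurface_subset_chordalSet.antisymm ?_
  rw [← pushout_image_demicube]
  rintro _ ⟨x, hx, rfl⟩
  rw [eq_point (pushout x)]
  exact (isDemicubePoint_of_mem_demicube hx).sinPoint_mem

/-! ### Quantum models give vectors in a unit ball -/

section Operators

variable {H : Type u} [NormedAddCommGroup H] [InnerProductSpace ℂ H]

lemma mem_spectrahedralShadow_of_re_inner {c : R4} {a b : Fin 2 → H} (ha : ∀ i, ‖a i‖ ≤ 1)
    (hb : ∀ j, ‖b j‖ ≤ 1) (h : ∀ i j, c i j = (⟪a i, b j⟫_ℂ).re) : c ∈ spectrahedralShadow := by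
  let _ : InnerProductSpace ℝ H := InnerProductSpace.rclikeToReal ℂ H
  exact mem_spectrahedralShadow_of_inner ha hb h

/-- This is Parseval's identity for T†ψ and ψ. -/
lemma hasTrace_rankOne_mul [CompleteSpace H] (ψ : H) (T : H →L[ℂ] H) :
    HasTrace (InnerProductSpace.rankOne ℂ ψ ψ * T) ⟪ψ, T ψ⟫_ℂ := by
  intro κ e
  have := e.hasSum_inner_mul_inner (ContinuousLinearMap.adjoint T ψ) ψ
  rw [ContinuousLinearMap.adjoint_inner_left] at this
  refine this.congr_fun fun k => ?_
  rw [ContinuousLinearMap.adjoint_inner_left]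
  simp

lemma isDensityOperator_rankOne [CompleteSpace H] {ψ : H} (hψ : ‖ψ‖ = 1) :
    IsDensityOperator (InnerProductSpace.rankOne ℂ ψ ψ) := by
  refine ⟨InnerProductSpace.isPositive_rankOne_self ψ, ?_⟩
  have := hasTrace_rankOne_mul ψ (1 : H →L[ℂ] H)
  simpa [inner_self_eq_norm_sq_to_K, hψ] using this

lemma isHermitianContraction_of_norm_le_one [CompleteSpace H] {A : H →L[ℂ] H}
    (hA : IsSelfAdjoint A) (h : ‖A‖ ≤ 1) : IsHermitianContraction A := by
  have h1 : algebraMap ℝ (H →L[ℂ] H) ‖A‖ ≤ 1 := by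
    have := algebraMap_mono (H →L[ℂ] H) h
    simpa using this
  exact ⟨hA, (neg_le_neg h1).trans hA.neg_algebraMap_norm_le_self,
    hA.le_algebraMap_norm_self.trans h1⟩

/-- 1 - A² = (1 + A)(1 - A) is a product of commuting positive operators, hence positive. -/
lemma IsHermitianContraction.norm_apply_le [CompleteSpace H] {A : H →L[ℂ] H}
    (hA : IsHermitianContraction A) (x : H) : ‖A x‖ ≤ ‖x‖ := by
  obtain ⟨hs, h₁, h₂⟩ := hA
  have h₁ : 0 ≤ 1 + A := by simpa [add_comm] using sub_nonneg.2 h₁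
  have h₂ : 0 ≤ 1 - A := sub_nonneg.2 h₂
  have hcomm : Commute (1 + A) (1 - A) := by
    rw [commute_iff_eq]; noncomm_ring
  have h : 0 ≤ (1 + A) * (1 - A) := hcomm.mul_nonneg h₁ h₂
  have hA2 : (1 + A) * (1 - A) = 1 - A * A := by noncomm_ring
  rw [hA2, ContinuousLinearMap.nonneg_iff_isPositive] at h
  have := h.re_inner_nonneg_left x
  have hAA : ⟪A (A x), x⟫_ℂ = ⟪A x, A x⟫_ℂ := by
    conv_lhs => rw [← hs.adjoint_eq, ContinuousLinearMap.adjoint_inner_left, hs.adjoint_eq]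
  rw [sub_apply, inner_sub_left, mul_apply_eq_comp, hAA] at this
  simp [inner_self_eq_norm_sq_to_K] at this
  norm_cast at this
  exact abs_le_of_sq_le_sq' (by linarith) (norm_nonneg x) |>.2

lemma hasSum_norm_inner_sq {κ : Type*} (e : HilbertBasis κ ℂ H) (x : H) :
    HasSum (fun k => ‖⟪e k, x⟫_ℂ‖ ^ 2) (‖x‖ ^ 2) := by
  have := Complex.hasSum_re (e.hasSum_inner_mul_inner x x)
  have hx : (⟪x, x⟫_ℂ).re = ‖x‖ ^ 2 := inner_self_eq_norm_sq (𝕜 := ℂ) x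
  rw [hx] at this
  refine this.congr_fun fun k => ?_
  rw [← inner_conj_symm x, RCLike.conj_mul]
  norm_cast

/-- The matrix entries of a Hilbert–Schmidt operator are square summable. -/
lemma summable_norm_inner_apply_sq {κ : Type*} (e : HilbertBasis κ ℂ H) {T : H → H}
    (hT : Summable fun k => ‖T (e k)‖ ^ 2) :
    Summable fun p : κ × κ => ‖⟪e p.2, T (e p.1)⟫_ℂ‖ ^ 2 := by
  refine (summable_prod_of_nonneg fun p => sq_nonneg _).2
    ⟨fun k => (hasSum_norm_inner_sq e (T (e k))).summable, ?_⟩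
  have h : ∀ k, ∑' l, ‖⟪e l, T (e k)⟫_ℂ‖ ^ 2 = ‖T (e k)‖ ^ 2 := fun k =>
    (hasSum_norm_inner_sq e (T (e k))).tsum_eq
  simpa only [h] using hT

/-- The trace of the product of two Hilbert–Schmidt operators is cyclic. -/
lemma hasSum_inner_comm {κ : Type*} (e : HilbertBasis κ ℂ H) [CompleteSpace H]
    {S T : H →L[ℂ] H} {t : ℂ} (hS : Summable fun k => ‖S (e k)‖ ^ 2)
    (hT : Summable fun k => ‖T (e k)‖ ^ 2)
    (h : HasSum (fun k => ⟪S (e k), ContinuousLinearMap.adjoint T (e k)⟫_ℂ) t) :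
    HasSum (fun k => ⟪T (e k), ContinuousLinearMap.adjoint S (e k)⟫_ℂ) t := by
  -- Both traces are iterated sums of this double series, which converges absolutely by comparison
  -- with the sum of the squares.
  have hsum : Summable fun p : κ × κ => ⟪S (e p.1), e p.2⟫_ℂ * ⟪T (e p.2), e p.1⟫_ℂ := by
    refine .of_norm_bounded ((summable_norm_inner_apply_sq e hS).add
      (summable_norm_inner_apply_sq e hT).prod_symm) fun p => ?_
    rw [norm_mul, ← norm_inner_symm (e p.2), ← norm_inner_symm (e p.1)]
    simp only [Prod.fst_swap, Prod.snd_swap]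
    nlinarith [sq_nonneg (‖⟪e p.2, S (e p.1)⟫_ℂ‖ - ‖⟪e p.1, T (e p.2)⟫_ℂ‖),
      sq_nonneg (‖⟪e p.2, S (e p.1)⟫_ℂ‖), sq_nonneg (‖⟪e p.1, T (e p.2)⟫_ℂ‖)]
  obtain ⟨s, hs⟩ := hsum
  have h₁ := hs.prod_fiberwise (g := fun k => ⟪S (e k), ContinuousLinearMap.adjoint T (e k)⟫_ℂ)
    fun k => by
      have := e.hasSum_inner_mul_inner (S (e k)) (ContinuousLinearMap.adjoint T (e k))
      simpa only [ContinuousLinearMap.adjoint_inner_right] using this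
  have h₂ := ((Equiv.prodComm κ κ).hasSum_iff.2 hs).prod_fiberwise
    (g := fun k => ⟪T (e k), ContinuousLinearMap.adjoint S (e k)⟫_ℂ) fun k => by
      refine (e.hasSum_inner_mul_inner (T (e k))
        (ContinuousLinearMap.adjoint S (e k))).congr_fun fun l => ?_
      rw [ContinuousLinearMap.adjoint_inner_right]
      exact mul_comm _ _
  rwa [h.unique h₁]

/-- A quantum model yields vectors of the unit ball of a Hilbert space, namely the Hilbert–Schmidt
operators `Aᵢ √ρ` and `Bⱼ √ρ`, whose scalar products are the correlations. -/
lemma IsQuantumModel.mem_spectrahedralShadow [CompleteSpace H] {ρ : H →L[ℂ] H}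
    {A B : Fin 2 → H →L[ℂ] H} {c : R4} (hM : IsQuantumModel ρ A B c) :
    c ∈ spectrahedralShadow := by
  obtain ⟨⟨hρ, htr⟩, hA, hB, hcomm, hc⟩ := hM
  obtain ⟨w, e, -⟩ := exists_hilbertBasis ℂ H
  have hρ₀ : 0 ≤ ρ := (ContinuousLinearMap.nonneg_iff_isPositive ρ).2 hρ
  set S := CFC.sqrt ρ with hSdef
  have hSS : S * S = ρ := CFC.sqrt_mul_sqrt_self ρ hρ₀
  have hSa : ContinuousLinearMap.adjoint S = S :=
    (IsSelfAdjoint.of_nonneg (CFC.sqrt_nonneg ρ)).adjoint_eq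
  have hSsymm : ∀ x y, ⟪x, S y⟫_ℂ = ⟪S x, y⟫_ℂ := fun x y => by
    conv_lhs => rw [← hSa, ContinuousLinearMap.adjoint_inner_right]
  -- Trace one means that √ρ has Hilbert–Schmidt norm one.
  have hS : HasSum (fun k => ‖S (e k)‖ ^ 2) 1 := by
    have := Complex.hasSum_re (htr w e)
    rw [Complex.one_re] at this
    refine this.congr_fun fun k => ?_
    rw [← hSS, mul_apply_eq_comp, hSsymm]
    exact (inner_self_eq_norm_sq (𝕜 := ℂ) _).symm
  have hle : ∀ {T : H →L[ℂ] H}, IsHermitianContraction T → ∀ k,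
      ‖T (S (e k))‖ ^ 2 ≤ ‖S (e k)‖ ^ 2 := fun hT k =>
    pow_le_pow_left₀ (norm_nonneg _) (hT.norm_apply_le _) 2
  have hTS : ∀ {T : H →L[ℂ] H}, IsHermitianContraction T →
      Summable fun k => ‖T (S (e k))‖ ^ 2 := fun hT =>
    .of_nonneg_of_le (fun k => by positivity) (hle hT) hS.summable
  have hmem : ∀ {T : H →L[ℂ] H}, IsHermitianContraction T →
      Memℓp (fun k => T (S (e k))) 2 := fun hT => by
    refine memℓp_gen ?_
    simpa using hTS hT
  -- The Hilbert–Schmidt operator T√ρ is encoded by its square-summable family of columns.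
  let X : (T : H →L[ℂ] H) → IsHermitianContraction T → lp (fun _ : w => H) 2 :=
    fun T hT => ⟨fun k => T (S (e k)), hmem hT⟩
  have hX : ∀ T hT, ‖X T hT‖ ≤ 1 := by
    intro T hT
    have h₁ := lp.hasSum_norm (p := 2) (by norm_num) (X T hT)
    have h₂ : ‖X T hT‖ ^ 2 ≤ 1 := by
      refine hasSum_le (fun k => hle hT k) ?_ hS
      simpa [X] using h₁
    exact (sq_le_one_iff₀ (norm_nonneg _)).1 h₂
  refine mem_spectrahedralShadow_of_re_inner (a := fun i => X (A i) (hA i))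
    (b := fun j => X (B j) (hB j)) (fun i => hX _ (hA i)) (fun j => hX _ (hB j)) fun i j => ?_
  have hAs := (hA i).selfAdjoint.adjoint_eq
  have hBs := (hB j).selfAdjoint.adjoint_eq
  have hAB : ContinuousLinearMap.adjoint (A i * B j * S) = S * (A i * B j) := by
    rw [(hcomm i j).eq]
    simp only [← ContinuousLinearMap.star_eq_adjoint] at *
    simp only [star_mul, hAs, hBs, hSa, mul_assoc]
    rw [(hcomm i j).eq]
  have hABS : Summable fun k => ‖(A i * B j * S) (e k)‖ ^ 2 :=
    .of_nonneg_of_le (fun k => by positivity) (fun k =>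
      (pow_le_pow_left₀ (norm_nonneg _) ((hA i).norm_apply_le _) 2).trans (hle (hB j) k))
      hS.summable
  -- Cyclicity moves one factor √ρ: tr(√ρ · √ρAB) = tr(AB√ρ · √ρ).
  have htrace := hasSum_inner_comm e hS.summable hABS (t := c i j) (by
    convert hc i j w e using 2 with k
    rw [hAB, ← hSS, ← hSsymm]
    simp [mul_assoc])
  have hin : HasSum (fun k => ⟪X (B j) (hB j) k, X (A i) (hA i) k⟫_ℂ) (c i j : ℂ) := by
    convert htrace using 2 with k
    conv_rhs => rw [hSa, mul_apply_eq_comp, mul_apply_eq_comp, ← hAs,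
      ContinuousLinearMap.adjoint_inner_left]
  have := (lp.hasSum_inner (𝕜 := ℂ) (X (B j) (hB j)) (X (A i) (hA i))).unique hin
  rw [← inner_conj_symm, this]
  simp

end Operators

lemma quantumCorrelations_subset_spectrahedralShadow :
    quantumCorrelations.{u} ⊆ spectrahedralShadow := by
  rintro c ⟨H, _, _, _, _, ρ, A, B, hM⟩
  exact hM.mem_spectrahedralShadow

/-! ### Realization by two qubits -/

/-- The space of two qubits. -/
abbrev TwoQubit : Type u := EuclideanSpace ℂ (ULift.{u} (Fin 4))

/-- The operator on two qubits given by a `4 × 4` matrix. -/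
noncomputable def qubitOperator :
    Matrix (Fin 4) (Fin 4) ℂ ≃⋆ₐ[ℂ] (TwoQubit.{u} →L[ℂ] TwoQubit.{u}) :=
  (StarAlgEquiv.ofAlgEquiv (Matrix.reindexAlgEquiv ℂ ℂ Equiv.ulift.symm) fun M => by
    ext; simp [Matrix.star_eq_conjTranspose]).trans Matrix.toEuclideanCLM

/-- The vector of two qubits with the given coordinates. -/
def qubitVector (v : Fin 4 → ℂ) : TwoQubit.{u} := WithLp.toLp 2 fun k => v k.down

lemma inner_qubitOperator (M : Matrix (Fin 4) (Fin 4) ℂ) (v : Fin 4 → ℂ) :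
    ⟪qubitVector.{u} v, qubitOperator M (qubitVector v)⟫_ℂ = star v ⬝ᵥ M.mulVec v := by
  rw [EuclideanSpace.inner_eq_star_dotProduct, dotProduct_comm]
  have h : WithLp.ofLp (qubitOperator.{u} M (qubitVector v)) =
      (M.submatrix ULift.down ULift.down).mulVec (v ∘ ULift.down) := rfl
  rw [h]
  simp only [dotProduct, Matrix.mulVec, ← Equiv.ulift.symm.sum_comp]
  rfl

/-- The reflection-like matrix `[[p, q], [q, -p]]` acting on the first qubit. -/
def aliceMatrix (p q : ℝ) : Matrix (Fin 4) (Fin 4) ℂ :=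
  !![p, 0, q, 0; 0, p, 0, q; q, 0, -p, 0; 0, q, 0, -p]

/-- The reflection-like matrix `[[p, q], [q, -p]]` acting on the second qubit. -/
def bobMatrix (p q : ℝ) : Matrix (Fin 4) (Fin 4) ℂ :=
  !![p, q, 0, 0; q, -p, 0, 0; 0, 0, p, q; 0, 0, q, -p]

/-- The C*-identity gives ‖M‖² = ‖M²‖ = r. -/
lemma isHermitianContraction_qubitOperator {M : Matrix (Fin 4) (Fin 4) ℂ} (hM : M.IsHermitian)
    {r : ℝ} (hr₀ : 0 ≤ r) (hr : r ≤ 1) (h : M * M = (r : ℂ) • 1) :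
    IsHermitianContraction (qubitOperator.{u} M) := by
  have hs : IsSelfAdjoint (qubitOperator.{u} M) := by
    rw [IsSelfAdjoint, ← map_star]
    exact congrArg _ hM
  refine isHermitianContraction_of_norm_le_one hs ?_
  have h₁ : ‖qubitOperator.{u} M‖ ^ 2 ≤ 1 := by
    rw [← hs.norm_mul_self, ← map_mul, h, map_smul, map_one, norm_smul]
    simpa [abs_of_nonneg hr₀] using hr
  exact (sq_le_one_iff₀ (norm_nonneg _)).1 h₁

lemma isHermitianContraction_aliceMatrix {p q : ℝ} (h : p ^ 2 + q ^ 2 ≤ 1) :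
    IsHermitianContraction (qubitOperator.{u} (aliceMatrix p q)) := by
  refine isHermitianContraction_qubitOperator ?_ (by positivity) h ?_
  · ext i j
    fin_cases i <;> fin_cases j <;> simp [aliceMatrix]
  · ext i j
    fin_cases i <;> fin_cases j <;>
      simp [aliceMatrix, Matrix.mul_apply, Fin.sum_univ_four] <;> ring

lemma isHermitianContraction_bobMatrix {p q : ℝ} (h : p ^ 2 + q ^ 2 ≤ 1) :
    IsHermitianContraction (qubitOperator.{u} (bobMatrix p q)) := by
  refine isHermitianContraction_qubitOperator ?_ (by positivity) h ?_
  · ext i j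
    fin_cases i <;> fin_cases j <;> simp [bobMatrix]
  · ext i j
    fin_cases i <;> fin_cases j <;>
      simp [bobMatrix, Matrix.mul_apply, Fin.sum_univ_four] <;> ring

/-- The matrices act on different tensor factors. -/
lemma commute_aliceMatrix_bobMatrix (p q r s : ℝ) :
    Commute (aliceMatrix p q) (bobMatrix r s) := by
  rw [commute_iff_eq]
  ext i j
  fin_cases i <;> fin_cases j <;>
    simp [aliceMatrix, bobMatrix, Matrix.mul_apply, Fin.sum_univ_four] <;> ring

/-- The maximally entangled state of two qubits. -/
noncomputable def bellVector : Fin 4 → ℂ := ![(√2 / 2 : ℝ), 0, 0, (√2 / 2 : ℝ)]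

lemma bellVector_inner (M : Matrix (Fin 4) (Fin 4) ℂ) :
    star bellVector ⬝ᵥ M.mulVec bellVector = (M 0 0 + M 0 3 + M 3 0 + M 3 3) / 2 := by
  have h : ((√2 : ℝ) : ℂ) ^ 2 = 2 := by
    norm_cast; simp
  have h2 : (starRingEnd ℂ) 2 = 2 := Complex.conj_ofNat 2
  simp [bellVector, Matrix.mulVec, dotProduct, Fin.sum_univ_four, h2]
  linear_combination (M 0 0 + M 0 3 + M 3 0 + M 3 3) / 4 * h

/-- In the Bell state the product of the matrices with parameters (p, q) and (r, s) has expectation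
p r + q s. Bob's vectors may stay inside the disc, since only contractions are required. -/
lemma chordalSet_subset_quantumCorrelations : chordalSet ⊆ quantumCorrelations.{u} := by
  intro c hc
  obtain ⟨p, q, r, s, ha, hb, hab⟩ := exists_planar_vectors hc
  have hψ : ‖qubitVector.{u} bellVector‖ = 1 := by
    have h := inner_qubitOperator.{u} 1 bellVector
    rw [map_one, one_apply_eq_self, bellVector_inner,
      inner_self_eq_norm_sq_to_K] at h
    simp at h
    norm_cast at h
    rcases h with h | h
    · exact h
    · exact absurd (norm_nonneg (qubitVector.{u} bellVector)) (by rw [h]; norm_num)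
  refine ⟨TwoQubit.{u}, inferInstance, inferInstance, inferInstance, inferInstance,
    InnerProductSpace.rankOne ℂ (qubitVector bellVector) (qubitVector bellVector),
    fun i => qubitOperator (aliceMatrix (p i) (q i)),
    fun j => qubitOperator (bobMatrix (r j) (s j)), isDensityOperator_rankOne hψ,
    fun i => isHermitianContraction_aliceMatrix (ha i).le,
    fun j => isHermitianContraction_bobMatrix (hb j),
    fun i j => (commute_aliceMatrix_bobMatrix _ _ _ _).map qubitOperator, fun i j => ?_⟩
  have := hasTrace_rankOne_mul (qubitVector.{u} bellVector)
    (qubitOperator (aliceMatrix (p i) (q i) * bobMatrix (r j) (s j)))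
  rw [inner_qubitOperator, bellVector_inner, map_mul, ← mul_assoc] at this
  convert this using 1
  simp [hab, aliceMatrix, bobMatrix, Matrix.mul_apply, Fin.sum_univ_four]
  ring

lemma quantumCorrelations_eq_chordalSet : quantumCorrelations.{u} = chordalSet :=
  (quantumCorrelations_subset_spectrahedralShadow.trans
    spectrahedralShadow_subset_chordalSet).antisymm chordalSet_subset_quantumCorrelations

end CorrelationBody

theorem theorem1 :
    CorrelationBody.quantumCorrelations.{u} = convexHull ℝ CorrelationBody.cosineSurface ∧
    CorrelationBody.quantumCorrelations.{u} =
      CorrelationBody.pushout '' CorrelationBody.demicube ∧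
    (∃ e : CorrelationBody.cube ≃ₜ CorrelationBody.cube,
      ∀ c : CorrelationBody.cube,
        (e c : CorrelationBody.R4) = CorrelationBody.pushout (c : CorrelationBody.R4)) ∧
    CorrelationBody.quantumCorrelations.{u} = CorrelationBody.semialgebraicSet ∧
    CorrelationBody.quantumCorrelations.{u} = CorrelationBody.spectrahedralShadow ∧
    CorrelationBody.quantumCorrelations.{u} = CorrelationBody.unitVectorCorrelations := by
  rw [CorrelationBody.quantumCorrelations_eq_chordalSet,
    CorrelationBody.convexHull_cosineSurface_eq_chordalSet,
    CorrelationBody.pushout_image_demicube, ← CorrelationBody.chordalSet_eq_semialgebraicSet,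
    CorrelationBody.spectrahedralShadow_eq_chordalSet,
    CorrelationBody.unitVectorCorrelations_eq_chordalSet]
  exact ⟨rfl, rfl, ⟨CorrelationBody.pushoutHomeomorph, fun _ => rfl⟩, rfl, rfl, rfl⟩
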